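/- Let $n\ge 1$ and $m\ge 0$ be integers. For a set $Q\subseteq\mathbb Z$ let $G_{n,m}(Q)$ be the simple graph whose vertices are all $v=(v_0,\dots,v_{m+1})\in\mathbb Z_n\times Q^m\times\mathbb Z_n$ with $\sum_{i=0}^{m+1}v_i\equiv 0\pmod n$, where two distinct vertices $u,v$ are adjacent if there is $0\le i\le m$ such that $u_j=v_j$ for all $j\notin\{i,i+1\}$ and either $u_i=v_i+1$, $u_{i+1}=v_{i+1}-1$, or $u_i=v_i-1$, $u_{i+1}=v_{i+1}+1$ (the entries $0$ and $m+1$ are computed in $\mathbb Z_n$, the others in $\mathbb Z$). The Yoke graph is $Y_{n,m}=G_{n,m}(\{0,1\})$ and the dYoke graph is $Z_{n,m}=G_{n,m}(\{-1,0,1\})$; $0$ denotes the all-zero vertex, and $\mathrm{ecc}_G(v)$ is the maximal distance in $G$ from $v$ to a vertex of $G$. Theorem. For all $n\ge 1$ and $m\ge 0$, $\mathrm{ecc}_{Z_{n,m}}(0)=\mathrm{ecc}_{Y_{n,m}}(0)$, and this common value is given as follows. 1. If $n=1$, then $\mathrm{ecc}_{Z_{n,m}}(0)=\binom{\lceil m/2\rceil+1}{2}+\binom{\lfloor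 m/2\rfloor+1}{2}$. 2. If $0\le m\le n$, then $\mathrm{ecc}_{Z_{n,m}}(0)=\left\lfloor\frac{n(m+1)}{2}\right\rfloor$. 3. If $2\le n\le m$, let $d_0=\binom{\lfloor\frac{m+n}{2}\rfloor+1}{2}+\binom{\lceil\frac{m-n}{2}\rceil+1}{2}$. Then (a) if $2\mid(m-n)$ or $n\le\lceil\frac{m+1}{2}\rceil$, then $\mathrm{ecc}_{Z_{n,m}}(0)=d_0$; (b) otherwise, $\mathrm{ecc}_{Z_{n,m}}(0)=d_0+n-\lceil\frac{m+1}{2}\rceil$. -/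

import Mathlib

/-- The vertices of a yoke-type graph whose inner entries are taken from `Q`: sequences
`(v₀, …, v_{m+1})` in `ℤ_n × Q^m × ℤ_n` whose sum is divisible by `n`. The two buckets `v₀` and
`v_{m+1}` are elements of `ℤ_n`, identified with their smallest non-negative representatives. -/
@[ext]
structure YokeSeq (Q : Set ℤ) (n m : ℕ) where
  entry : Fin (m + 2) → ℤ
  left_bucket : 0 ≤ entry 0 ∧ entry 0 < n
  right_bucket : 0 ≤ entry (Fin.last (m + 1)) ∧ entry (Fin.last (m + 1)) < n
  inner : ∀ j, j ≠ 0 → j ≠ Fin.last (m + 1) → entry j ∈ Q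
  sum_dvd : (n : ℤ) ∣ ∑ j, entry j

/-- Equality of two values at position `j`: in `ℤ_n` if `j` is a bucket, in `ℤ` otherwise. -/
def YokeEntryEq (n m : ℕ) (j : Fin (m + 2)) (a b : ℤ) : Prop :=
  if j = 0 ∨ j = Fin.last (m + 1) then a ≡ b [ZMOD n] else a = b

/-- `u` is obtained from `v` by shifting a unit from entry `i + 1` to the left. -/
def YokeSeq.IsLeftShift {Q : Set ℤ} {n m : ℕ} (i : Fin (m + 1)) (u v : YokeSeq Q n m) : Prop :=
  YokeEntryEq n m i.castSucc (u.entry i.castSucc) (v.entry i.castSucc + 1) ∧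
    YokeEntryEq n m i.succ (u.entry i.succ) (v.entry i.succ - 1)

/-- `u` is obtained from `v` by shifting a unit from entry `i` to the right. -/
def YokeSeq.IsRightShift {Q : Set ℤ} {n m : ℕ} (i : Fin (m + 1)) (u v : YokeSeq Q n m) : Prop :=
  YokeEntryEq n m i.castSucc (u.entry i.castSucc) (v.entry i.castSucc - 1) ∧
    YokeEntryEq n m i.succ (u.entry i.succ) (v.entry i.succ + 1)

theorem YokeEntryEq.symm_add {n m : ℕ} {j : Fin (m + 2)} {a b : ℤ}
    (h : YokeEntryEq n m j a (b + 1)) : YokeEntryEq n m j b (a - 1) := by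
  unfold YokeEntryEq at *
  split_ifs at * with hj
  · have := (h.sub_right 1).symm
    rwa [add_sub_cancel_right] at this
  · omega

theorem YokeEntryEq.symm_sub {n m : ℕ} {j : Fin (m + 2)} {a b : ℤ}
    (h : YokeEntryEq n m j a (b - 1)) : YokeEntryEq n m j b (a + 1) := by
  unfold YokeEntryEq at *
  split_ifs at * with hj
  · have := (h.add_right 1).symm
    rwa [sub_add_cancel] at this
  · omega

/-- The graph on `YokeSeq Q n m` in which two distinct vertices are adjacent if one is obtained
from the other by a unit shift between two consecutive entries. (Distinctness only matters for
`n = 1`, `m = 0`, where it excludes a loop at the single vertex.) -/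
def yokeTypeGraph (Q : Set ℤ) (n m : ℕ) : SimpleGraph (YokeSeq Q n m) where
  Adj u v := u ≠ v ∧ ∃ i : Fin (m + 1),
    (∀ j, j ≠ i.castSucc → j ≠ i.succ → u.entry j = v.entry j) ∧
      (u.IsLeftShift i v ∨ u.IsRightShift i v)
  symm := by
    constructor
    rintro u v ⟨hne, i, hj, h⟩
    refine ⟨hne.symm, i, fun j h1 h2 => (hj j h1 h2).symm, ?_⟩
    rcases h with h | h
    · exact Or.inr ⟨h.1.symm_add, h.2.symm_sub⟩
    · exact Or.inl ⟨h.1.symm_sub, h.2.symm_add⟩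
  loopless := ⟨fun _ h => h.1 rfl⟩

/-- The all-zero sequence. -/
def YokeSeq.zero {Q : Set ℤ} (hQ : (0 : ℤ) ∈ Q) {n : ℕ} (m : ℕ) (hn : 1 ≤ n) : YokeSeq Q n m where
  entry _ := 0
  left_bucket := ⟨le_rfl, by exact_mod_cast hn⟩
  right_bucket := ⟨le_rfl, by exact_mod_cast hn⟩
  inner _ _ _ := hQ
  sum_dvd := by simp

/-- The Yoke graph `Y_{n,m}`: inner entries in `{0, 1}`. -/
abbrev yokeGraph (n m : ℕ) : SimpleGraph (YokeSeq {0, 1} n m) := yokeTypeGraph {0, 1} n m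

/-- The dYoke graph `Z_{n,m}`: inner entries in `{-1, 0, 1}`. -/
abbrev dYokeGraph (n m : ℕ) : SimpleGraph (YokeSeq {-1, 0, 1} n m) := yokeTypeGraph {-1, 0, 1} n m

/-- The vertex `0` of `Y_{n,m}`. -/
def yokeZero {n : ℕ} (m : ℕ) (hn : 1 ≤ n) : YokeSeq {0, 1} n m := YokeSeq.zero (by simp) m hn

/-- The vertex `0` of `Z_{n,m}`. -/
def dYokeZero {n : ℕ} (m : ℕ) (hn : 1 ≤ n) : YokeSeq {-1, 0, 1} n m := YokeSeq.zero (by simp) m hn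

/-- `binom(⌊(m+n)/2⌋ + 1, 2) + binom(⌈(m-n)/2⌉ + 1, 2)`, used only for `n ≤ m`
(`⌈/⌉` is division rounded up). -/
def yokeD0 (n m : ℕ) : ℕ :=
  Nat.choose ((m + n) / 2 + 1) 2 + Nat.choose ((m - n) ⌈/⌉ 2 + 1) 2

/-!
A vertex `v` is determined by its height function, the partial sums `h i = v₀ + ⋯ + vᵢ` for
`0 ≤ i ≤ m`, which is unique up to adding a constant multiple of `n`. Its steps are the inner
entries, and a move changes one height by `±1`; the vertex `0` has the constant heights `n k`.
Lowering the first maximum above a target, or dually raising a minimum, keeps the steps in an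
interval containing `0` and `1`, so the distance from `v` to `0` is `min_k ∑ᵢ |h i - n k|`. Only
the multiset of heights matters here, and sorting a path with steps in `{-1, 0, 1}` gives one with
steps in `{0, 1}`: this is why the two eccentricities agree.

Pairing `i` with its mirror image `m - i` and using `|x| + |y| = max |x + y| |x - y|`, twice the
distance to the constant `c` is `∑ᵢ max |h i + h (m - i) - 2c| |h i - h (m - i)|`. Let
`b = ⌊(m - n) / 2⌋`, and let `n k ≤ h b < n (k + 1)` for a sorted path `h`. Either
`h (m - b) ≤ n (k + 1)`, and the better of the two levels `n k` and `n (k + 1)` is close enough on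
average, or `h` crosses the level `n (k + 1)` between `b` and `m - b`, and that level is close.
The first case is sharp for a path symmetric about height `n / 2` with a plateau in the middle, the
second one for the path of constant slope `1`.
-/

/-! ### Paths of heights -/

section Heights

variable {m : ℕ} {Q : Set ℤ} {h : Fin (m + 1) → ℤ} {c : ℤ}

/-- A height function all of whose increments lie in `Q`: the heights of a vertex with inner
entries in `Q`. -/
def HasStepsIn (Q : Set ℤ) (h : Fin (m + 1) → ℤ) : Prop :=
  ∀ i : Fin m, h i.succ - h i.castSucc ∈ Q

theorem HasStepsIn.mono {R : Set ℤ} (hh : HasStepsIn Q h) (hQR : Q ⊆ R) : HasStepsIn R h :=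
  fun i => hQR (hh i)

theorem HasStepsIn.abs_sub_le (hh : HasStepsIn (Set.Icc (-1) 1) h) (i j : Fin (m + 1)) :
    |h i - h j| ≤ |(i : ℤ) - j| := by
  have hadd : Monotone fun i => h i + (i : ℤ) := Fin.monotone_iff_le_succ.2 fun i => by
    have := (hh i).1
    simp only [Fin.val_castSucc, Fin.val_succ]
    omega
  have hsub : Antitone fun i => h i - (i : ℤ) := Fin.antitone_iff_succ_le.2 fun i => by
    have := (hh i).2
    simp only [Fin.val_castSucc, Fin.val_succ]
    omega
  rcases le_total i j with hij | hij <;>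
    have h₁ := hadd hij <;> have h₂ := hsub hij <;> grind

theorem HasStepsIn.exists_eq (hh : HasStepsIn (Set.Icc (-1) 1) h) {i j : Fin (m + 1)}
    (hi : h i ≤ c) (hj : c ≤ h j) : ∃ l, h l = c := by
  by_contra! hne
  have same_side (l : Fin (m + 1)) : h l < c ↔ h 0 < c := by
    induction l using Fin.induction with
    | zero => rfl
    | succ l ih =>
      have := hh l
      rw [Set.mem_Icc] at this
      grind
  grind

theorem HasStepsIn.comp_sort (hh : HasStepsIn (Set.Icc (-1) 1) h) :
    HasStepsIn (Set.Icc 0 1) (h ∘ Tuple.sort h) := by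
  intro i
  have hmono := Tuple.monotone_sort h
  refine ⟨sub_nonneg.2 (hmono i.castSucc_le_succ), ?_⟩
  by_contra! hgap
  obtain ⟨l, hl⟩ := hh.exists_eq (c := (h ∘ Tuple.sort h) i.castSucc + 1)
    (i := Tuple.sort h i.castSucc) (j := Tuple.sort h i.succ)
    (by simp) (by simp only [Function.comp_apply] at *; omega)
  obtain ⟨t, rfl⟩ := (Tuple.sort h).surjective l
  rcases le_or_gt t i.castSucc with ht | ht
  · have := hmono ht
    simp only [Function.comp_apply] at *
    omega
  · have := hmono (Fin.castSucc_lt_iff_succ_le.1 ht)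
    simp only [Function.comp_apply] at *
    omega

theorem HasStepsIn.neg_comp_rev (hh : HasStepsIn Q h) : HasStepsIn Q fun i => -h i.rev := by
  intro i
  have := hh i.rev
  rwa [← Fin.rev_castSucc, ← Fin.rev_succ, ← neg_sub_neg] at this

theorem HasStepsIn.exists_lower [Q.OrdConnected] (hQ0 : 0 ∈ Q) (hQ1 : 1 ∈ Q)
    (hh : HasStepsIn Q h) {i : Fin (m + 1)} (hi : c < h i) :
    ∃ j, c < h j ∧ HasStepsIn Q (h + Pi.single j (-1)) := by
  obtain ⟨j, -, hj⟩ := Finset.exists_max_image Finset.univ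
    (fun i => toLex (h i, OrderDual.toDual i)) ⟨i, Finset.mem_univ i⟩
  have hmax (l : Fin (m + 1)) : h l < h j ∨ h l = h j ∧ j ≤ l := by
    simpa [Prod.Lex.toLex_le_toLex] using hj l (Finset.mem_univ l)
  refine ⟨j, hi.trans_le ((hmax i).elim le_of_lt fun h => h.1.le), fun l => ?_⟩
  have hl := hh l
  have hlt := l.castSucc_lt_succ
  simp only [Pi.add_apply, Pi.single_apply]
  by_cases hs : l.succ = j
  · have := (hmax l.castSucc).resolve_right fun h => (hs ▸ h.2).not_gt hlt
    rw [if_pos hs, if_neg (hs ▸ hlt.ne), hs]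
    rw [hs] at hl
    exact Set.Icc_subset Q hQ0 hl ⟨by omega, by omega⟩
  by_cases hc : l.castSucc = j
  · have : h l.succ ≤ h j := (hmax l.succ).elim le_of_lt fun h => h.1.le
    rw [if_neg hs, if_pos hc, hc]
    rw [hc] at hl
    exact Set.Icc_subset Q hl hQ1 ⟨by omega, by omega⟩
  · simpa [hs, hc]

theorem HasStepsIn.exists_raise [Q.OrdConnected] (hQ0 : 0 ∈ Q) (hQ1 : 1 ∈ Q)
    (hh : HasStepsIn Q h) {i : Fin (m + 1)} (hi : h i < c) :
    ∃ j, h j < c ∧ HasStepsIn Q (h + Pi.single j 1) := by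
  obtain ⟨j, hj, hstep⟩ := hh.neg_comp_rev.exists_lower hQ0 hQ1 (c := -c) (i := i.rev) (by simpa)
  refine ⟨j.rev, by simpa using hj, ?_⟩
  convert hstep.neg_comp_rev using 1
  ext l
  simp only [Pi.add_apply, Pi.single_apply, Fin.rev_eq_iff, Fin.rev_rev]
  split_ifs <;> ring

end Heights

/-! ### Distance to a constant path -/

section ConstDist

variable {ι : Type*} [Fintype ι]

/-- The `ℓ¹`-distance from `h` to the constant function `c`. -/
def constDist (h : ι → ℤ) (c : ℤ) : ℕ := ∑ i, (h i - c).natAbs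

theorem constDist_eq_zero_iff {h : ι → ℤ} {c : ℤ} : constDist h c = 0 ↔ ∀ i, h i = c := by
  simp [constDist, sub_eq_zero]

theorem constDist_comp_perm (h : ι → ℤ) (σ : Equiv.Perm ι) (c : ℤ) :
    constDist (h ∘ σ) c = constDist h c :=
  Equiv.sum_comp σ fun i => (h i - c).natAbs

theorem constDist_add_single [DecidableEq ι] (h : ι → ℤ) (c : ℤ) (i : ι) (a : ℤ) :
    constDist (h + Pi.single i a) c + (h i - c).natAbs =
      constDist h c + (h i + a - c).natAbs := by
  have hne : ∑ j ∈ {i}ᶜ, ((h + Pi.single i a : ι → ℤ) j - c).natAbs =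
      ∑ j ∈ {i}ᶜ, (h j - c).natAbs :=
    Finset.sum_congr rfl fun j hj => by simp [show j ≠ i by simpa using hj]
  rw [constDist, constDist, Fintype.sum_eq_add_sum_compl i, Fintype.sum_eq_add_sum_compl i, hne,
    Pi.add_apply, Pi.single_eq_same]
  ring

theorem constDist_le_constDist_add_single [DecidableEq ι] (h : ι → ℤ) (c : ℤ) (i : ι) (ε : ℤˣ) :
    constDist h c ≤ constDist (h + Pi.single i (ε : ℤ)) c + 1 := by
  have := constDist_add_single h c i ε
  rcases Int.units_eq_one_or ε with rfl | rfl <;> push_cast at * <;> omega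

theorem HasStepsIn.exists_step_toward {m : ℕ} {Q : Set ℤ} [Q.OrdConnected] (hQ0 : 0 ∈ Q)
    (hQ1 : 1 ∈ Q) {h : Fin (m + 1) → ℤ} {c : ℤ} (hh : HasStepsIn Q h) (hc : constDist h c ≠ 0) :
    ∃ (i : Fin (m + 1)) (ε : ℤˣ), HasStepsIn Q (h + Pi.single i (ε : ℤ)) ∧
      constDist (h + Pi.single i (ε : ℤ)) c + 1 = constDist h c := by
  obtain ⟨i, hi⟩ := not_forall.1 (mt constDist_eq_zero_iff.2 hc)
  rcases lt_or_gt_of_ne hi with hlt | hgt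
  · obtain ⟨j, hj, hstep⟩ := hh.exists_raise hQ0 hQ1 hlt
    have := constDist_add_single h c j 1
    exact ⟨j, 1, hstep, by rw [Units.val_one]; omega⟩
  · obtain ⟨j, hj, hstep⟩ := hh.exists_lower hQ0 hQ1 hgt
    have := constDist_add_single h c j (-1)
    exact ⟨j, -1, hstep, by rw [Units.val_neg, Units.val_one]; omega⟩

end ConstDist

/-! ### Bounds by reflection -/

section Reflection

variable {m : ℕ} {h : Fin (m + 1) → ℤ} {c : ℤ}

theorem abs_add_abs_eq_max (a b : ℤ) : |a| + |b| = max |a + b| |a - b| := by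
  grind

theorem two_mul_constDist (h : Fin (m + 1) → ℤ) (c : ℤ) :
    2 * (constDist h c : ℤ) = ∑ i, max |h i + h i.rev - 2 * c| |h i - h i.rev| := by
  have hrev := Equiv.sum_comp Fin.revPerm fun i => |h i - c|
  simp only [constDist, Nat.cast_sum, Int.natCast_natAbs]
  rw [two_mul]
  nth_rw 2 [← hrev]
  rw [← Finset.sum_add_distrib]
  refine Finset.sum_congr rfl fun i _ => ?_
  rw [abs_add_abs_eq_max]
  simp only [Fin.revPerm_apply]
  ring_nf

/-- How far the position `i` lies outside the middle part `b ≤ i ≤ m - b` of `{0, …, m}`. At most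
one of the two truncated differences is nonzero if `2 * b ≤ m + 1`. -/
def overhang (b : ℕ) (i : Fin (m + 1)) : ℕ := (b - i) + (b - i.rev)

theorem two_mul_sum_range_sub {b N : ℕ} (hb : b ≤ N) :
    2 * ∑ i ∈ Finset.range N, (b - i) = b * (b + 1) := by
  induction b generalizing N with
  | zero => simp
  | succ b ih =>
    obtain ⟨N, rfl⟩ := Nat.exists_eq_add_one_of_ne_zero (by omega : N ≠ 0)
    simp only [Finset.sum_range_succ', Nat.add_sub_add_right, mul_add,
      ih (Nat.le_of_succ_le_succ hb)]
    grind

theorem sum_overhang {b : ℕ} (hb : b ≤ m + 1) : ∑ i : Fin (m + 1), overhang b i = b * (b + 1) := by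
  have hrev : ∑ i : Fin (m + 1), (b - (i.rev : ℕ)) = ∑ i : Fin (m + 1), (b - (i : ℕ)) :=
    Equiv.sum_comp Fin.revPerm fun i => b - (i : ℕ)
  simp only [overhang, Finset.sum_add_distrib, hrev]
  rw [Fin.sum_univ_eq_sum_range (fun i => b - i), ← two_mul, two_mul_sum_range_sub hb]

theorem max_abs_sub_two_mul {b : ℕ} (hb : 2 * b ≤ m + 1) (i : Fin (m + 1)) :
    max |(m : ℤ) - 2 * i| (m - 2 * b) = m - 2 * b + 2 * overhang b i := by
  rw [overhang, Fin.val_rev]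
  grind

theorem sum_max_abs_sub_two_mul {b : ℕ} (hb : 2 * b ≤ m + 1) :
    ∑ i : Fin (m + 1), max |(m : ℤ) - 2 * i| (m - 2 * b) =
      (m + 1) * (m - 2 * b) + 2 * b * (b + 1) := by
  simp only [max_abs_sub_two_mul hb, Finset.sum_add_distrib, ← Finset.mul_sum, ← Nat.cast_sum,
    sum_overhang (by omega : b ≤ m + 1), Fin.sum_const, nsmul_eq_mul]
  push_cast
  ring

theorem HasStepsIn.two_mul_constDist_le_of_lt_of_lt (hh : HasStepsIn (Set.Icc (-1) 1) h)
    {b : Fin (m + 1)} (hb : 2 * (b : ℕ) < m) (hlt : h b < c) (hgt : c < h b.rev) :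
    2 * (constDist h c : ℤ) ≤ (m + 1) * (m - 2 * (b + 1)) + 2 * (b + 1) * (b + 2) := by
  have hsum := sum_max_abs_sub_two_mul (m := m) (b := b + 1) (by omega)
  push_cast at hsum
  rw [two_mul_constDist, show (b : ℤ) + 2 = b + 1 + 1 by ring, ← hsum]
  refine Finset.sum_le_sum fun i _ => max_le ?_ ?_
  -- The values at `b` bound `h i + h i.rev` from above, those at `b.rev` bound it from below.
  · have h₁ := hh.abs_sub_le i b
    have h₂ := hh.abs_sub_le i.rev b
    have h₃ := hh.abs_sub_le i b.rev
    have h₄ := hh.abs_sub_le i.rev b.rev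
    have h₅ := abs_add_abs_eq_max (i - b : ℤ) (i.rev - b)
    simp only [Fin.val_rev] at *
    rw [le_max_iff]
    grind
  · have := hh.abs_sub_le i i.rev
    rw [Fin.val_rev] at this
    grind

theorem HasStepsIn.constDist_add_constDist_le (hh : HasStepsIn (Set.Icc 0 1) h) {d : ℤ}
    {b : Fin (m + 1)} (hb : 2 * (b : ℕ) ≤ m) (hc : c ≤ h b) (hd : h b.rev ≤ d) :
    (constDist h c + constDist h d : ℤ) ≤ (d - c) * (m + 1) + 2 * b * (b + 1) := by
  have hmono : Monotone h := Fin.monotone_iff_le_succ.2 fun i => sub_nonneg.1 (hh i).1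
  have hlip := (hh.mono (Set.Icc_subset_Icc_left (by norm_num))).abs_sub_le
  have pointwise (i : Fin (m + 1)) : |h i - c| + |h i - d| ≤ d - c + 2 * overhang b i := by
    have hbb : b ≤ b.rev := by rw [Fin.le_def, Fin.val_rev]; omega
    have h₁ := hmono hbb
    have h₂ := hlip i b
    have h₃ := hlip i b.rev
    have h₄ := @hmono i b
    have h₅ := @hmono b i
    have h₆ := @hmono i b.rev
    have h₇ := @hmono b.rev i
    simp only [overhang, Fin.val_rev, Fin.le_def] at *
    grind
  calc (constDist h c + constDist h d : ℤ)
      = ∑ i, (|h i - c| + |h i - d|) := by simp [constDist, Finset.sum_add_distrib]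
    _ ≤ ∑ i : Fin (m + 1), (d - c + 2 * overhang b i : ℤ) :=
      Finset.sum_le_sum fun i _ => pointwise i
    _ = (d - c) * (m + 1) + 2 * b * (b + 1) := by
      simp only [Finset.sum_add_distrib, ← Finset.mul_sum, ← Nat.cast_sum,
        sum_overhang (by omega : (b : ℕ) ≤ m + 1), Fin.sum_const, nsmul_eq_mul]
      push_cast
      ring

theorem HasStepsIn.exists_constDist_le {n b B : ℕ} (hn : 1 ≤ n)
    (hh : HasStepsIn (Set.Icc (-1) 1) h) (hb : 2 * b ≤ m)
    (hB₁ : n * (m + 1) + 2 * b * (b + 1) ≤ (2 * B + 1 : ℤ))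
    (hB₂ : 2 * b < m → (m + 1) * (m - 2 * (b + 1)) + 2 * (b + 1) * (b + 2) ≤ (2 * B + 1 : ℤ)) :
    ∃ k : ℤ, constDist h (n * k) ≤ B := by
  set g := h ∘ Tuple.sort h
  have hg : HasStepsIn (Set.Icc 0 1) g := hh.comp_sort
  obtain ⟨b, rfl⟩ : ∃ i : Fin (m + 1), (i : ℕ) = b := ⟨⟨b, by omega⟩, rfl⟩
  simp only [← constDist_comp_perm h (Tuple.sort h)]
  change ∃ k : ℤ, constDist g (n * k) ≤ B
  set k := g b / n
  have hn' : (0 : ℤ) < n := by exact_mod_cast hn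
  have hk : n * k ≤ g b := Int.mul_ediv_self_le hn'.ne'
  have hk' : g b < n * (k + 1) := by
    rw [mul_add, mul_one]
    exact Int.lt_mul_ediv_self_add hn'
  by_cases hrev : g b.rev ≤ n * (k + 1)
  · have hsum := hg.constDist_add_constDist_le hb hk hrev
    rw [show n * (k + 1) - n * k = (n : ℤ) by ring] at hsum
    rcases le_total (constDist g (n * k)) (constDist g (n * (k + 1))) with hle | hle
    · exact ⟨k, by omega⟩
    · exact ⟨k + 1, by omega⟩
  · have hb' : 2 * (b : ℕ) < m := by
      refine hb.lt_of_ne fun hm => hrev ?_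
      have : b.rev = b := Fin.ext (by rw [Fin.val_rev]; omega)
      rw [this]
      exact hk'.le
    have := (hg.mono (Set.Icc_subset_Icc_left (by norm_num))).two_mul_constDist_le_of_lt_of_lt
      hb' hk' (not_le.1 hrev)
    exact ⟨k + 1, by linarith [hB₂ hb']⟩

theorem le_constDist_of_sum_max {B : ℕ} {d : Fin (m + 1) → ℤ}
    (hd : ∀ i, d i ≤ |h i + h i.rev - 2 * c|)
    (hB : 2 * B ≤ ∑ i, max (d i) |h i - h i.rev| + 1) : B ≤ constDist h c := by
  have : ∑ i, max (d i) |h i - h i.rev| ≤ 2 * (constDist h c : ℤ) := by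
    rw [two_mul_constDist]
    exact Finset.sum_le_sum fun i _ => max_le_max_right _ (hd i)
  omega

theorem abs_le_abs_sub_two_mul_mul {s n : ℤ} (hs : |s| ≤ n) (k : ℤ) : |s| ≤ |s - 2 * (n * k)| := by
  rcases lt_trichotomy k 0 with hk | rfl | hk
  · have : n * k ≤ -n := by nlinarith [abs_nonneg s]
    grind
  · simp
  · have : n ≤ n * k := by nlinarith [abs_nonneg s]
    grind

end Reflection

/-! ### Extremal paths -/

/-- A path with `h i + h (m - i) = n` away from the middle, which rises with slope `1` at both ends
and stays near `n / 2` in between. It is as far as possible from all levels `n * k` at once. -/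
def balancedHeight (n m : ℕ) (i : Fin (m + 1)) : ℤ :=
  if 2 * (i : ℕ) ≤ m then min (i - ((m : ℤ) - n) / 2) (n / 2)
  else max (i - (m - n + 1 : ℤ) / 2) ((n + 1 : ℤ) / 2)

theorem hasStepsIn_balancedHeight (n m : ℕ) :
    HasStepsIn (Set.Icc 0 1) (balancedHeight n m) := by
  intro i
  simp only [balancedHeight, Fin.val_succ, Fin.val_castSucc, Set.mem_Icc]
  push_cast
  grind

/-- The distance from `balancedHeight n m` to the nearest constant path at a multiple of `n`. The
truncated `m - n` makes the second summand vanish for `m ≤ n`. -/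
def balancedRadius (n m : ℕ) : ℕ := n * (m + 1) / 2 + (m - n) / 2 * ((m - n) / 2 + 1)

theorem balancedRadius_le_constDist (n m : ℕ) (k : ℤ) :
    balancedRadius n m ≤ constDist (balancedHeight n m) (n * k) := by
  set b := (m - n) / 2 with hb
  let mid : Fin (m + 1) := ⟨m / 2, by omega⟩
  let d (i : Fin (m + 1)) : ℤ := if i = mid then n - 1 else n
  refine le_constDist_of_sum_max (d := d) (fun i => ?_) ?_
  · have := abs_le_abs_sub_two_mul_mul (s := n) (n := n) (by simp) k
    simp only [d, mid, balancedHeight, Fin.ext_iff, Fin.val_rev]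
    grind
  · have pointwise (i : Fin (m + 1)) : d i + 2 * overhang b i ≤
        max (d i) |balancedHeight n m i - balancedHeight n m i.rev| := by
      simp only [d, mid, balancedHeight, overhang, Fin.ext_iff, Fin.val_rev, hb]
      grind
    have hd : ∑ i, d i = n * (m + 1) - 1 := by
      have (i : Fin (m + 1)) : d i = n - if i = mid then 1 else 0 := by grind
      simp only [this, Finset.sum_sub_distrib, Finset.sum_ite_eq', Finset.mem_univ, if_true,
        Fin.sum_const, nsmul_eq_mul]
      push_cast
      ring
    have hsum := Finset.sum_le_sum fun i (_ : i ∈ Finset.univ) => pointwise i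
    rw [Finset.sum_add_distrib, hd, ← Finset.mul_sum, ← Nat.cast_sum,
      sum_overhang (by omega : b ≤ m + 1)] at hsum
    have := Int.mul_ediv_self_le (x := n * (m + 1)) (k := 2) (by norm_num)
    rw [balancedRadius, ← hb]
    push_cast at *
    linarith

theorem two_mul_succ_choose_two (x : ℕ) : 2 * (x + 1).choose 2 = x * (x + 1) := by
  rw [Nat.choose_two_right, Nat.mul_div_cancel' (Nat.even_mul_pred_self _).two_dvd,
    Nat.add_sub_cancel, mul_comm]

theorem two_mul_yokeD0 {n m β : ℕ} (hnm : n ≤ m) (hβ : (m - n) ⌈/⌉ 2 = β) :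
    2 * (yokeD0 n m : ℤ) = (m + 1) * (m - 2 * β) + 2 * β * (β + 1) := by
  have hfloor : (m + n) / 2 = m - β := by
    rw [Nat.ceilDiv_eq_add_pred_div] at hβ
    omega
  have hle : β ≤ m := by
    rw [Nat.ceilDiv_eq_add_pred_div] at hβ
    omega
  have h₁ := two_mul_succ_choose_two (m - β)
  have h₂ := two_mul_succ_choose_two β
  rw [yokeD0, hfloor, hβ]
  zify [hle] at *
  linarith

theorem yokeD0_le_constDist {n m : ℕ} (hn : 1 ≤ n) (hnm : n ≤ m) (k : ℤ) :
    yokeD0 n m ≤ constDist (fun i : Fin (m + 1) => (i - ((m - n) ⌈/⌉ 2 : ℕ) : ℤ)) (n * k) := by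
  obtain ⟨β, hβ⟩ : ∃ β, (m - n) ⌈/⌉ 2 = β := ⟨_, rfl⟩
  have hD := two_mul_yokeD0 hnm hβ
  rw [hβ]
  rw [Nat.ceilDiv_eq_add_pred_div] at hβ
  refine le_constDist_of_sum_max (d := fun _ => m - 2 * β) (fun i => ?_) ?_
  · have := abs_le_abs_sub_two_mul_mul (s := m - 2 * β) (n := n) (by grind) k
    simp only [Fin.val_rev]
    grind
  · have habs (i : Fin (m + 1)) : |(i - β : ℤ) - (i.rev - β)| = |(m : ℤ) - 2 * i| := by
      rw [Fin.val_rev]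
      grind
    simp only [habs, max_comm _ |_|]
    rw [sum_max_abs_sub_two_mul (by omega)]
    omega

/-- `B` is the largest possible distance from a path to the nearest constant path at a multiple of
`n`, both among the paths with steps in `{-1, 0, 1}` and among those with steps in `{0, 1}`. -/
structure IsMinimaxDist (n m B : ℕ) : Prop where
  exists_constDist_le : ∀ h : Fin (m + 1) → ℤ, HasStepsIn (Set.Icc (-1) 1) h →
    ∃ k : ℤ, constDist h (n * k) ≤ B
  exists_le_constDist : ∃ h : Fin (m + 1) → ℤ, HasStepsIn (Set.Icc 0 1) h ∧
    ∀ k : ℤ, B ≤ constDist h (n * k)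

theorem isMinimaxDist_of_le {n m : ℕ} (hn : 1 ≤ n) (hmn : m ≤ n) :
    IsMinimaxDist n m (n * (m + 1) / 2) := by
  have hB : n * (m + 1) / 2 = balancedRadius n m := by
    simp [balancedRadius, Nat.sub_eq_zero_of_le hmn]
  refine ⟨fun h hh => hh.exists_constDist_le hn (b := 0) (by omega) ?_ ?_,
    balancedHeight n m, hasStepsIn_balancedHeight n m, fun k => ?_⟩
  · push_cast
    omega
  · intro hm
    have : (m + 1) * (m - 2) + 4 ≤ (n * (m + 1) : ℤ) := by nlinarith
    push_cast
    omega
  · rw [hB]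
    exact balancedRadius_le_constDist n m k

theorem isMinimaxDist_of_ge {n m : ℕ} (hn : 1 ≤ n) (hnm : n ≤ m) :
    IsMinimaxDist n m (max (yokeD0 n m) (balancedRadius n m)) := by
  obtain ⟨b, hb⟩ : ∃ b, (m - n) / 2 = b := ⟨_, rfl⟩
  obtain ⟨β, hβ⟩ : ∃ β, (m - n) ⌈/⌉ 2 = β := ⟨_, rfl⟩
  have hD := two_mul_yokeD0 hnm hβ
  rw [Nat.ceilDiv_eq_add_pred_div] at hβ
  refine ⟨fun h hh => hh.exists_constDist_le hn (b := b) (by omega) ?_ fun hbm => ?_, ?_⟩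
  · have : n * (m + 1) + 2 * b * (b + 1) ≤ 2 * balancedRadius n m + 1 := by
      rw [balancedRadius, hb, mul_assoc]
      omega
    exact_mod_cast this.trans (by gcongr; exact le_max_right _ _)
  · have : yokeD0 n m ≤ max (yokeD0 n m) (balancedRadius n m) := le_max_left _ _
    obtain rfl | rfl : β = b ∨ β = b + 1 := by omega
    all_goals
      push_cast at *
      linarith
  · rcases max_choice (yokeD0 n m) (balancedRadius n m) with hmax | hmax <;> rw [hmax]
    · exact ⟨_, fun i => by simp, yokeD0_le_constDist hn hnm⟩
    · exact ⟨_, hasStepsIn_balancedHeight n m, balancedRadius_le_constDist n m⟩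

theorem balancedRadius_eq_yokeD0 {n m : ℕ} (hnm : n ≤ m) (h : 2 ∣ m - n) :
    balancedRadius n m = yokeD0 n m := by
  obtain ⟨b, hb⟩ := h
  have hD := two_mul_yokeD0 hnm (β := b) (by rw [Nat.ceilDiv_eq_add_pred_div]; omega)
  obtain rfl : m = n + 2 * b := by omega
  have heven : 2 * (n * (n + 2 * b + 1) / 2) = n * (n + 2 * b + 1) :=
    Nat.mul_div_cancel' (by grind : Even (n * (n + 2 * b + 1))).two_dvd
  rw [balancedRadius, show (n + 2 * b - n) / 2 = b by omega]
  zify at heven ⊢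
  push_cast at hD
  linarith

theorem balancedRadius_add_ceilDiv {n m : ℕ} (hnm : n ≤ m) (h : ¬ 2 ∣ m - n) :
    balancedRadius n m + (m + 1) ⌈/⌉ 2 = yokeD0 n m + n := by
  obtain ⟨b, hb⟩ : ∃ b, m - n = 2 * b + 1 := ⟨(m - n) / 2, by omega⟩
  have hD := two_mul_yokeD0 hnm (β := b + 1) (by rw [Nat.ceilDiv_eq_add_pred_div]; omega)
  obtain rfl : m = n + 2 * b + 1 := by omega
  have hparity : 2 * (n * (n + 2 * b + 2) / 2 + (n + 1) / 2) = n * (n + 2 * b + 3) := by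
    obtain ⟨a, rfl | rfl⟩ := n.even_or_odd' <;> grind
  rw [balancedRadius, Nat.ceilDiv_eq_add_pred_div, show (n + 2 * b + 1 - n) / 2 = b by omega,
    show (n + 2 * b + 1 + 1 + 2 - 1) / 2 = (n + 1) / 2 + (b + 1) by omega]
  zify at hparity ⊢
  push_cast at hD
  rw [show (n + 2 * b + 1 + 1 : ℤ) = n + 2 * b + 2 by ring]
  linarith

theorem isMinimaxDist_yokeD0 {n m : ℕ} (hn : 1 ≤ n) (hnm : n ≤ m)
    (h : 2 ∣ m - n ∨ n ≤ (m + 1) ⌈/⌉ 2) : IsMinimaxDist n m (yokeD0 n m) := by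
  have hle : balancedRadius n m ≤ yokeD0 n m := by
    by_cases hpar : 2 ∣ m - n
    · exact (balancedRadius_eq_yokeD0 hnm hpar).le
    · have := balancedRadius_add_ceilDiv hnm hpar
      have := h.resolve_left hpar
      omega
  simpa only [max_eq_left hle] using isMinimaxDist_of_ge hn hnm

theorem isMinimaxDist_yokeD0_add {n m : ℕ} (hn : 1 ≤ n) (hnm : n ≤ m)
    (h : ¬ (2 ∣ m - n ∨ n ≤ (m + 1) ⌈/⌉ 2)) :
    IsMinimaxDist n m (yokeD0 n m + (n - (m + 1) ⌈/⌉ 2)) := by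
  obtain ⟨hpar, hlt⟩ := not_or.1 h
  have heq : balancedRadius n m = yokeD0 n m + (n - (m + 1) ⌈/⌉ 2) := by
    rw [← Nat.add_sub_assoc (not_le.1 hlt).le, ← balancedRadius_add_ceilDiv hnm hpar,
      Nat.add_sub_cancel]
  simpa only [heq, max_eq_right (Nat.le_add_right _ _)] using isMinimaxDist_of_ge hn hnm

theorem isMinimaxDist_one (m : ℕ) :
    IsMinimaxDist 1 m ((m ⌈/⌉ 2 + 1).choose 2 + (m / 2 + 1).choose 2) := by
  rcases m.eq_zero_or_pos with rfl | hm
  · exact isMinimaxDist_of_le le_rfl zero_le_one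
  · have hD : yokeD0 1 m = (m ⌈/⌉ 2 + 1).choose 2 + (m / 2 + 1).choose 2 := by
      simp only [yokeD0, Nat.ceilDiv_eq_add_pred_div, show m - 1 + 2 - 1 = m by omega,
        show m + 2 - 1 = m + 1 by omega]
    rw [← hD]
    refine isMinimaxDist_yokeD0 le_rfl hm (Or.inr ?_)
    rw [Nat.ceilDiv_eq_add_pred_div]
    omega

theorem exists_isMinimaxDist {n : ℕ} (hn : 1 ≤ n) (m : ℕ) : ∃ B, IsMinimaxDist n m B := by
  rcases le_total m n with hmn | hnm
  · exact ⟨_, isMinimaxDist_of_le hn hmn⟩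
  · exact ⟨_, isMinimaxDist_of_ge hn hnm⟩

/-! ### Heights of vertices -/

section HeightDiff

variable {m : ℕ} (h : Fin (m + 1) → ℤ)

/-- The sequence with partial sums `h`: the entry `j` is `h j - h (j - 1)`, where `h` is extended by
`0` at both ends. In particular its last entry makes the total sum zero. -/
def heightDiff (j : Fin (m + 2)) : ℤ :=
  Fin.snoc (α := fun _ => ℤ) h 0 j - Fin.cons (α := fun _ => ℤ) 0 h j

theorem heightDiff_zero : heightDiff h 0 = h 0 := by
  rw [heightDiff, Fin.cons_zero, ← Fin.castSucc_zero, Fin.snoc_castSucc, sub_zero]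

theorem heightDiff_last : heightDiff h (Fin.last (m + 1)) = -h (Fin.last m) := by
  rw [heightDiff, Fin.snoc_last, ← Fin.succ_last, Fin.cons_succ, zero_sub]

theorem heightDiff_castSucc_succ (i : Fin m) :
    heightDiff h i.castSucc.succ = h i.succ - h i.castSucc := by
  rw [heightDiff, Fin.cons_succ, Fin.succ_castSucc, Fin.snoc_castSucc]

theorem sum_heightDiff : ∑ j, heightDiff h j = 0 := by
  simp [heightDiff, Fin.sum_snoc, Fin.sum_cons]

theorem heightDiff_add (g : Fin (m + 1) → ℤ) :
    heightDiff (h + g) = heightDiff h + heightDiff g := by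
  funext j
  cases j using Fin.lastCases with
  | last =>
    simp only [heightDiff_last, Pi.add_apply]
    ring
  | cast j =>
    cases j using Fin.cases with
    | zero => simp [heightDiff_zero]
    | succ j =>
      simp only [Fin.castSucc_succ, heightDiff_castSucc_succ, Pi.add_apply]
      ring

theorem heightDiff_single (i : Fin (m + 1)) (a : ℤ) :
    heightDiff (Pi.single i a) = Pi.single i.castSucc a - Pi.single i.succ a := by
  funext j
  rw [Pi.sub_apply, heightDiff]
  congr 1
  · cases j using Fin.lastCases <;> simp [Pi.single_apply]
  · cases j using Fin.cases <;> simp [Pi.single_apply]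

end HeightDiff

section EntryModulus

variable {n m : ℕ}

/-- The modulus of the entry `j`. It is `0` for inner entries, congruence modulo `0` being
equality. -/
def entryModulus (n : ℕ) (j : Fin (m + 2)) : ℤ := if j = 0 ∨ j = Fin.last (m + 1) then n else 0

theorem entryModulus_zero (n : ℕ) : entryModulus n (0 : Fin (m + 2)) = n := by
  simp [entryModulus]

theorem entryModulus_last (n : ℕ) : entryModulus n (Fin.last (m + 1)) = n := by
  simp [entryModulus]

theorem entryModulus_castSucc_succ (n : ℕ) (i : Fin m) : entryModulus n i.castSucc.succ = 0 := by
  simp [entryModulus, Fin.ext_iff, i.isLt.ne]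

theorem entryModulus_dvd (n : ℕ) (j : Fin (m + 2)) : (n : ℤ) ∣ entryModulus n j := by
  unfold entryModulus
  split_ifs <;> simp

theorem yokeEntryEq_iff_modEq {j : Fin (m + 2)} {a b : ℤ} :
    YokeEntryEq n m j a b ↔ a ≡ b [ZMOD entryModulus n j] := by
  unfold YokeEntryEq entryModulus
  split_ifs <;> simp

end EntryModulus

namespace YokeSeq

variable {Q : Set ℤ} {n m : ℕ} {u v : YokeSeq Q n m} {h : Fin (m + 1) → ℤ}

theorem entry_emod_entryModulus (v : YokeSeq Q n m) (j : Fin (m + 2)) :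
    v.entry j % entryModulus n j = v.entry j := by
  unfold entryModulus
  split_ifs with hj
  · rcases hj with rfl | rfl
    · exact Int.emod_eq_of_lt v.left_bucket.1 v.left_bucket.2
    · exact Int.emod_eq_of_lt v.right_bucket.1 v.right_bucket.2
  · exact Int.emod_zero _

theorem entry_eq_of_modEq {j : Fin (m + 2)}
    (huv : u.entry j ≡ v.entry j [ZMOD entryModulus n j]) : u.entry j = v.entry j := by
  rw [← u.entry_emod_entryModulus, huv, v.entry_emod_entryModulus]

theorem forall_modEq_add_heightDiff_single_iff {i : Fin (m + 1)} {a : ℤ} :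
    (∀ j, u.entry j ≡ v.entry j + heightDiff (Pi.single i a) j [ZMOD entryModulus n j]) ↔
      (∀ j, j ≠ i.castSucc → j ≠ i.succ → u.entry j = v.entry j) ∧
        YokeEntryEq n m i.castSucc (u.entry i.castSucc) (v.entry i.castSucc + a) ∧
        YokeEntryEq n m i.succ (u.entry i.succ) (v.entry i.succ - a) := by
  have hi := i.castSucc_lt_succ.ne
  simp only [yokeEntryEq_iff_modEq, heightDiff_single, Pi.sub_apply, Pi.single_apply]
  refine ⟨fun H => ⟨fun j h₁ h₂ => entry_eq_of_modEq ?_, ?_, ?_⟩, fun H j => ?_⟩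
  · simpa [h₁, h₂] using H j
  · simpa [hi] using H i.castSucc
  · simpa [hi.symm, sub_eq_add_neg] using H i.succ
  · by_cases h₁ : j = i.castSucc
    · subst h₁
      simpa [hi] using H.2.1
    by_cases h₂ : j = i.succ
    · subst h₂
      simpa [hi.symm, sub_eq_add_neg] using H.2.2
    · simp [h₁, h₂, H.1 j h₁ h₂]

theorem adj_iff_modEq : (yokeTypeGraph Q n m).Adj u v ↔ u ≠ v ∧ ∃ (i : Fin (m + 1)) (ε : ℤˣ),
    ∀ j, u.entry j ≡ v.entry j + heightDiff (Pi.single i (ε : ℤ)) j [ZMOD entryModulus n j] := by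
  refine and_congr_right fun _ => exists_congr fun i => ?_
  simp only [forall_modEq_add_heightDiff_single_iff]
  constructor
  · rintro ⟨hj, hl | hr⟩
    · exact ⟨1, hj, hl⟩
    · exact ⟨-1, hj, by simpa [sub_eq_add_neg, IsRightShift] using hr⟩
  · rintro ⟨ε, hj, hε⟩
    obtain rfl | rfl := Int.units_eq_one_or ε
    · exact ⟨hj, Or.inl hε⟩
    · exact ⟨hj, Or.inr (by simpa [sub_eq_add_neg, IsRightShift] using hε)⟩

/-- `h` consists of the partial sums of `v`, up to adding a constant multiple of `n`: the entries of
`v` are the differences of `h`, taken modulo `n` at the two buckets. -/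
def HasHeight (v : YokeSeq Q n m) (h : Fin (m + 1) → ℤ) : Prop :=
  ∀ j, v.entry j ≡ heightDiff h j [ZMOD entryModulus n j]

theorem HasHeight.eq (hu : u.HasHeight h) (hv : v.HasHeight h) : u = v :=
  YokeSeq.ext (funext fun j => entry_eq_of_modEq ((hu j).trans (hv j).symm))

theorem HasHeight.entry_eq_sub (hv : v.HasHeight h) (i : Fin m) :
    v.entry i.castSucc.succ = h i.succ - h i.castSucc := by
  have := hv i.castSucc.succ
  rwa [heightDiff_castSucc_succ, entryModulus_castSucc_succ, Int.modEq_zero_iff] at this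

theorem HasHeight.hasStepsIn (hv : v.HasHeight h) : HasStepsIn Q h := fun i => by
  rw [← hv.entry_eq_sub]
  exact v.inner _ (by simp [Fin.ext_iff]) (by simp [Fin.ext_iff, i.isLt.ne])

theorem exists_hasHeight_of_hasStepsIn (hn : 1 ≤ n) (hh : HasStepsIn Q h) :
    ∃ v : YokeSeq Q n m, v.HasHeight h := by
  have hn' : (0 : ℤ) < n := by exact_mod_cast hn
  have hmod (j : Fin (m + 2)) :
      heightDiff h j % entryModulus n j ≡ heightDiff h j [ZMOD entryModulus n j] :=
    Int.mod_modEq _ _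
  refine ⟨{ entry j := heightDiff h j % entryModulus n j
            left_bucket := ?_, right_bucket := ?_, inner j h₀ hl := ?_, sum_dvd := ?_ }, hmod⟩
  · simp [entryModulus, Int.emod_nonneg _ hn'.ne', Int.emod_lt_of_pos _ hn']
  · simp [entryModulus, Int.emod_nonneg _ hn'.ne', Int.emod_lt_of_pos _ hn']
  · simp only [entryModulus, h₀, hl, or_self, if_false, Int.emod_zero]
    obtain ⟨i, rfl⟩ := Fin.exists_succ_eq.2 h₀
    obtain ⟨i, rfl⟩ := Fin.exists_castSucc_eq.2 (by simpa using hl)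
    rw [heightDiff_castSucc_succ]
    exact hh i
  · rw [← Int.modEq_zero_iff_dvd, ← sum_heightDiff h]
    exact Int.ModEq.sum fun j _ => (hmod j).of_dvd (entryModulus_dvd n j)

theorem exists_hasHeight (v : YokeSeq Q n m) : ∃ h, v.HasHeight h := by
  set h : Fin (m + 1) → ℤ := fun i => Fin.partialSum v.entry i.castSucc.succ
  have hcast (i : Fin (m + 1)) : v.entry i.castSucc = heightDiff h i.castSucc := by
    cases i using Fin.cases with
    | zero => simp [h, Fin.castSucc_zero, heightDiff_zero, Fin.partialSum_succ]
    | succ i =>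
      rw [Fin.castSucc_succ, heightDiff_castSucc_succ, eq_sub_iff_add_eq']
      exact (Fin.partialSum_succ v.entry i.castSucc.succ).symm
  refine ⟨h, fun j => ?_⟩
  cases j using Fin.lastCases with
  | cast i => rw [hcast]
  | last =>
    have hdvd := v.sum_dvd
    rw [← sub_zero (∑ j, v.entry j), ← sum_heightDiff h, Fin.sum_univ_castSucc v.entry,
      Fin.sum_univ_castSucc (heightDiff h), Finset.sum_congr rfl fun i _ => hcast i,
      add_sub_add_left_eq_sub] at hdvd
    rw [entryModulus_last]
    exact (Int.modEq_iff_dvd.2 hdvd).symm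

theorem hasHeight_zero_iff (hQ : 0 ∈ Q) (hn : 1 ≤ n) :
    (zero hQ m hn).HasHeight h ↔ ∃ k : ℤ, ∀ i, h i = n * k := by
  constructor
  · intro hz
    have h₀ := hz 0
    rw [entryModulus_zero, heightDiff_zero, Int.modEq_comm] at h₀
    obtain ⟨k, hk⟩ := Int.modEq_zero_iff_dvd.1 h₀
    refine ⟨k, fun i => ?_⟩
    induction i using Fin.induction with
    | zero => exact hk
    | succ i ih => rw [← ih, ← sub_eq_zero, ← hz.entry_eq_sub]; rfl
  · rintro ⟨k, hk⟩ j
    cases j using Fin.lastCases with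
    | last => simp [heightDiff_last, hk, entryModulus_last, zero, Int.modEq_iff_dvd]
    | cast i =>
      cases i using Fin.cases with
      | zero => simp [heightDiff_zero, hk, entryModulus_zero, zero, Int.modEq_iff_dvd]
      | succ i => simp [heightDiff_castSucc_succ, hk, zero]

theorem HasHeight.add_single_of_adj (hv : v.HasHeight h) (huv : (yokeTypeGraph Q n m).Adj u v) :
    ∃ (i : Fin (m + 1)) (ε : ℤˣ), u.HasHeight (h + Pi.single i (ε : ℤ)) := by
  obtain ⟨-, i, ε, hiε⟩ := adj_iff_modEq.1 huv
  refine ⟨i, ε, fun j => (hiε j).trans ?_⟩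
  rw [heightDiff_add]
  exact (hv j).add_right _

theorem HasHeight.edist_le_one {i : Fin (m + 1)} {ε : ℤˣ} (hv : v.HasHeight h)
    (hu : u.HasHeight (h + Pi.single i (ε : ℤ))) : (yokeTypeGraph Q n m).edist u v ≤ 1 := by
  by_cases huv : u = v
  · simp [huv]
  · refine (SimpleGraph.edist_eq_one_iff_adj.2 (adj_iff_modEq.2 ⟨huv, i, ε, fun j => ?_⟩)).le
    refine (hu j).trans ?_
    rw [heightDiff_add]
    exact ((hv j).add_right _).symm

/-! ### Distances to the zero vertex -/

theorem HasHeight.edist_zero_le_constDist [Q.OrdConnected] (hQ0 : 0 ∈ Q) (hQ1 : 1 ∈ Q) (hn : 1 ≤ n)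
    (hv : v.HasHeight h) (k : ℤ) :
    (yokeTypeGraph Q n m).edist v (zero hQ0 m hn) ≤ constDist h (n * k) := by
  induction hd : constDist h (n * k) generalizing v h with
  | zero =>
    have hz := (hasHeight_zero_iff hQ0 hn).2 ⟨k, constDist_eq_zero_iff.1 hd⟩
    simp [hv.eq hz]
  | succ d ih =>
    obtain ⟨i, ε, hstep, hdist⟩ :=
      hv.hasStepsIn.exists_step_toward hQ0 hQ1 (hd.trans_ne d.succ_ne_zero)
    obtain ⟨u, hu⟩ := exists_hasHeight_of_hasStepsIn hn hstep
    calc (yokeTypeGraph Q n m).edist v (zero hQ0 m hn)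
        ≤ (yokeTypeGraph Q n m).edist v u + (yokeTypeGraph Q n m).edist u (zero hQ0 m hn) :=
          SimpleGraph.edist_triangle
      _ ≤ 1 + d := add_le_add (SimpleGraph.edist_comm.trans_le (hv.edist_le_one hu))
          (ih hu (Nat.succ.inj (hdist.trans hd)))
      _ = (d + 1 : ℕ) := by rw [add_comm, Nat.cast_succ]

theorem HasHeight.exists_constDist_le_length (hQ0 : 0 ∈ Q) (hn : 1 ≤ n) (hv : v.HasHeight h)
    (p : (yokeTypeGraph Q n m).Walk v (zero hQ0 m hn)) :
    ∃ k : ℤ, constDist h (n * k) ≤ p.length := by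
  generalize hw : zero hQ0 m hn = w at p
  induction p generalizing h with
  | nil =>
    subst hw
    obtain ⟨k, hk⟩ := (hasHeight_zero_iff hQ0 hn).1 hv
    exact ⟨k, (constDist_eq_zero_iff.2 hk).le⟩
  | cons hadj p ih =>
    obtain ⟨i, ε, hu⟩ := hv.add_single_of_adj hadj.symm
    obtain ⟨k, hk⟩ := ih hu hw
    exact ⟨k, (constDist_le_constDist_add_single h _ i ε).trans (Nat.succ_le_succ hk)⟩

theorem HasHeight.edist_zero_eq_iInf [Q.OrdConnected] (hQ0 : 0 ∈ Q) (hQ1 : 1 ∈ Q) (hn : 1 ≤ n)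
    (hv : v.HasHeight h) : (yokeTypeGraph Q n m).edist v (zero hQ0 m hn) =
      ⨅ k : ℤ, (constDist h (n * k) : ℕ∞) := by
  refine le_antisymm (le_iInf (hv.edist_zero_le_constDist hQ0 hQ1 hn)) (le_iInf fun p => ?_)
  obtain ⟨k, hk⟩ := hv.exists_constDist_le_length hQ0 hn p
  exact iInf_le_of_le k (by exact_mod_cast hk)

theorem eccent_zero_eq [Q.OrdConnected] (hQ : Set.Icc 0 1 ⊆ Q) (hQ' : Q ⊆ Set.Icc (-1) 1)
    (hn : 1 ≤ n) {B : ℕ} (hB : IsMinimaxDist n m B) :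
    (yokeTypeGraph Q n m).eccent (zero (hQ (Set.left_mem_Icc.2 zero_le_one)) m hn) = B := by
  have hQ1 : 1 ∈ Q := hQ (Set.right_mem_Icc.2 zero_le_one)
  refine le_antisymm (iSup_le fun v => ?_) ?_
  · obtain ⟨h, hv⟩ := v.exists_hasHeight
    obtain ⟨k, hk⟩ := hB.exists_constDist_le h (hv.hasStepsIn.mono hQ')
    rw [SimpleGraph.edist_comm, hv.edist_zero_eq_iInf _ hQ1 hn]
    exact iInf_le_of_le k (by exact_mod_cast hk)
  · obtain ⟨h, hh, hk⟩ := hB.exists_le_constDist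
    obtain ⟨v, hv⟩ := exists_hasHeight_of_hasStepsIn hn (hh.mono hQ)
    refine le_trans ?_ (SimpleGraph.edist_le_eccent (v := v))
    rw [SimpleGraph.edist_comm, hv.edist_zero_eq_iInf _ hQ1 hn]
    exact le_iInf fun k => by exact_mod_cast hk k

end YokeSeq

theorem eccent_yokeGraph {n m B : ℕ} (hn : 1 ≤ n) (hB : IsMinimaxDist n m B) :
    (yokeGraph n m).eccent (yokeZero m hn) = B := by
  have hQ : ({0, 1} : Set ℤ) = Set.Icc 0 1 := by ext; simp; omega
  have : ({0, 1} : Set ℤ).OrdConnected := hQ ▸ Set.ordConnected_Icc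
  exact YokeSeq.eccent_zero_eq hQ.ge (hQ.trans_subset (Set.Icc_subset_Icc_left (by simp))) hn hB

theorem eccent_dYokeGraph {n m B : ℕ} (hn : 1 ≤ n) (hB : IsMinimaxDist n m B) :
    (dYokeGraph n m).eccent (dYokeZero m hn) = B := by
  have hQ : ({-1, 0, 1} : Set ℤ) = Set.Icc (-1) 1 := by ext; simp; omega
  have : ({-1, 0, 1} : Set ℤ).OrdConnected := hQ ▸ Set.ordConnected_Icc
  exact YokeSeq.eccent_zero_eq ((Set.Icc_subset_Icc_left (by simp)).trans hQ.ge) hQ.le hn hB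

theorem mainTheorem4 (n m : ℕ) (hn : 1 ≤ n) :
    (dYokeGraph n m).eccent (dYokeZero m hn) = (yokeGraph n m).eccent (yokeZero m hn) ∧
    (n = 1 → (dYokeGraph n m).eccent (dYokeZero m hn) =
      ((Nat.choose (m ⌈/⌉ 2 + 1) 2 + Nat.choose (m / 2 + 1) 2 : ℕ) : ℕ∞)) ∧
    (m ≤ n → (dYokeGraph n m).eccent (dYokeZero m hn) = ((n * (m + 1) / 2 : ℕ) : ℕ∞)) ∧
    (2 ≤ n → n ≤ m →
      ((2 ∣ m - n ∨ n ≤ (m + 1) ⌈/⌉ 2) →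
        (dYokeGraph n m).eccent (dYokeZero m hn) = ((yokeD0 n m : ℕ) : ℕ∞)) ∧
      (¬ (2 ∣ m - n ∨ n ≤ (m + 1) ⌈/⌉ 2) →
        (dYokeGraph n m).eccent (dYokeZero m hn) =
          ((yokeD0 n m + (n - (m + 1) ⌈/⌉ 2) : ℕ) : ℕ∞))) := by
  obtain ⟨B, hB⟩ := exists_isMinimaxDist hn m
  refine ⟨by rw [eccent_dYokeGraph hn hB, eccent_yokeGraph hn hB], ?_, ?_, ?_⟩
  · rintro rfl
    exact eccent_dYokeGraph hn (isMinimaxDist_one m)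
  · exact fun hmn => eccent_dYokeGraph hn (isMinimaxDist_of_le hn hmn)
  · exact fun _ hnm => ⟨fun h => eccent_dYokeGraph hn (isMinimaxDist_yokeD0 hn hnm h),
      fun h => eccent_dYokeGraph hn (isMinimaxDist_yokeD0_add hn hnm h)⟩
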